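/- Let $k\ge 2$, let $V=\mathbb C^k$ with its standard basis $e_1,\dots,e_k$, and let $\mathfrak{Jord}_k$ be the set of bilinear maps $\mu:V\times V\to V$ that are Jordan multiplications, i.e. that are commutative and satisfy $(x^2y)x=x^2(yx)$. Give $\mathfrak{Jord}_k$ the Zariski topology in the $k^3$ structure constants, and let $GL(V)$ act by $(g*\mu)(x,y)=g\,\mu(g^{-1}x,g^{-1}y)$; write $O(\mu)$ for the orbit of $\mu$ (its isomorphism class) and $\overline{O(\mu)}$ for its closure. Call $\mu$ rigid if $O(\mu)$ is open in $\mathfrak{Jord}_k$. A proper degeneration $\mu\to\nu$ means $\nu\in\overline{O(\mu)}\setminus O(\mu)$, and the level of $\mu$ is the maximal length of a chain of proper degenerations starting at $\mu$. Let $\mathfrak J_k\in\mathfrak{Jord}_k$ be the algebra with basis $e,n_1,\dots,n_{k-1}$ (namely $e_1,\dots,e_k$) and commutative multiplication $e^2=e$, $en_i=\tfrac12 n_i$, $n_in_j=0$. Then: 1. If $\mu\in\mathfrak{Jord}_k$ is rigid of level one, then $\overline{O(\mu)}$ is an irreducible component of $\mathfrak{Jord}_k$, $\overline{O(\mu)}=O(\mu)\cup\{0\}$,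 and the zero multiplication $0$ is the only non-rigid point of $\overline{O(\mu)}$. 2. The algebra $\mathfrak J_k$ is rigid and of level one, and $\overline{O(\mathfrak J_k)}$ meets the intersection of all the other irreducible components of $\mathfrak{Jord}_k$ exactly in the point $0$. 3. There is no $\nu\in\mathfrak{Jord}_k$ with $\nu\neq0$ that lies in every irreducible component of $\mathfrak{Jord}_k$. Thus the analogue for Jordan algebras of Gorbatsevich's statement on Lie algebras (that some algebra with nonzero multiplication lies in all irreducible components) fails in every dimension $k\ge2$. -/

import Mathlib

noncomputable section

namespace JordVar

/-- The complex vector space `V` of dimension `k`, with its standard basis fixed. -/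
abbrev Vec (k : ℕ) : Type := Fin k → ℂ

/-- All (not necessarily associative) algebra structures on `V`, as bilinear maps `V × V → V`. -/
abbrev AlgStr (k : ℕ) : Type := Vec k →ₗ[ℂ] Vec k →ₗ[ℂ] Vec k

/-- The structure constants `c_{i,j}^l`, determined by `e_i e_j = ∑ l, c_{i,j}^l e_l`. -/
def structConst {k : ℕ} (μ : AlgStr k) : Fin k × Fin k × Fin k → ℂ :=
  fun t => μ (Pi.single t.1 1) (Pi.single t.2.1 1) t.2.2

/-- The set of algebra structures whose structure constants satisfy all equations `p = 0`,
`p ∈ S`. -/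
def zeroSet {k : ℕ} (S : Set (MvPolynomial (Fin k × Fin k × Fin k) ℂ)) : Set (AlgStr k) :=
  {μ | ∀ p ∈ S, MvPolynomial.eval (structConst μ) p = 0}

/-- The Zariski topology on the affine space of algebra structures: the closed sets are the sets
defined by polynomial equations in the structure constants. -/
@[reducible] def zariskiTopology (k : ℕ) : TopologicalSpace (AlgStr k) :=
  TopologicalSpace.ofClosed {T | ∃ S, T = zeroSet S}
    ⟨{1}, by ext μ; simp [zeroSet]⟩
    (by
      intro A hA
      refine ⟨{p | ∃ S, zeroSet S ∈ A ∧ p ∈ S}, ?_⟩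
      ext μ
      constructor
      · rintro h p ⟨S, hS, hp⟩
        exact h _ hS p hp
      · intro h T hT
        obtain ⟨S, rfl⟩ := hA hT
        exact fun p hp => h p ⟨S, hT, hp⟩)
    (by
      rintro _ ⟨S, rfl⟩ _ ⟨T, rfl⟩
      refine ⟨{r | ∃ p ∈ S, ∃ q ∈ T, r = p * q}, ?_⟩
      ext μ
      constructor
      · rintro (h | h) _ ⟨p, hp, q, hq, rfl⟩
        · rw [map_mul, h p hp, zero_mul]
        · rw [map_mul, h q hq, mul_zero]
      · intro h
        by_cases hS : μ ∈ zeroSet S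
        · exact Or.inl hS
        · right
          intro q hq
          simp only [zeroSet, Set.mem_ofPred_eq, not_forall] at hS
          obtain ⟨p, hp, hne⟩ := hS
          have h1 := h _ ⟨p, hp, q, hq, rfl⟩
          rw [map_mul] at h1
          exact (mul_eq_zero.mp h1).resolve_left hne)

/-- A Jordan multiplication: commutative, with `(x² y) x = x² (y x)`. -/
def IsJordanMul {k : ℕ} (μ : AlgStr k) : Prop :=
  (∀ x y, μ x y = μ y x) ∧ ∀ x y, μ (μ (μ x x) y) x = μ (μ x x) (μ y x)

/-- The variety of Jordan algebra structures on the `k`-dimensional space `V`. -/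
def Jord (k : ℕ) : Type := {μ : AlgStr k // IsJordanMul μ}

/-- The Zariski topology of the variety of Jordan algebras, as a subspace of `AlgStr k`. -/
instance (k : ℕ) : TopologicalSpace (Jord k) :=
  TopologicalSpace.induced Subtype.val (zariskiTopology k)

/-- The algebra with zero multiplication. -/
instance (k : ℕ) : Zero (Jord k) :=
  ⟨⟨0, by constructor <;> intros <;> simp⟩⟩

/-- The orbit of `μ` under `(g * μ)(x, y) = g (μ (g⁻¹ x, g⁻¹ y))`, `g ∈ GL(V)`. It is the
isomorphism class of the algebra `μ`. -/
def orbit {k : ℕ} (μ : Jord k) : Set (Jord k) :=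
  {ν | ∃ g : Vec k ≃ₗ[ℂ] Vec k, ∀ x y, ν.1 x y = g (μ.1 (g.symm x) (g.symm y))}

/-- `μ` is rigid if its orbit is open in the variety of Jordan algebras. -/
def IsRigid {k : ℕ} (μ : Jord k) : Prop := IsOpen (orbit μ)

/-- `μ` degenerates to `ν` if `ν` lies in the Zariski closure of the orbit of `μ`. -/
def Degenerates {k : ℕ} (μ ν : Jord k) : Prop := ν ∈ closure (orbit μ)

/-- A degeneration between non-isomorphic algebras. -/
def ProperDegeneration {k : ℕ} (μ ν : Jord k) : Prop := Degenerates μ ν ∧ ν ∉ orbit μ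

/-- The level of `μ`: the maximal length of a chain `μ = μ₀ → μ₁ → ⋯ → μₙ` of proper
degenerations. -/
def level {k : ℕ} (μ : Jord k) : ℕ∞ :=
  ⨆ (c : RelSeries {p : Jord k × Jord k | ProperDegeneration p.1 p.2}) (_ : c.head = μ),
    (c.length : ℕ∞)

/-- The underlying multiplication of `𝔍_k`, namely `x y = (x₀ y + y₀ x) / 2`, where `x₀` is the
coordinate of `x` at the first basis vector `e`. -/
def marginalMul (k : ℕ) (hk : 2 ≤ k) : AlgStr k :=
  LinearMap.mk₂ ℂ
    (fun x y => (1 / 2 : ℂ) • (x ⟨0, by omega⟩ • y + y ⟨0, by omega⟩ • x))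
    (by intros; ext; simp; ring) (by intros; ext; simp; ring)
    (by intros; ext; simp; ring) (by intros; ext; simp; ring)

/-- The `k`-dimensional Jordan algebra `𝔍_k` with basis `e, n₁, …, n_{k-1}` and `e² = e`,
`e nᵢ = nᵢ / 2`, `nᵢ nⱼ = 0`. -/
def marginal (k : ℕ) (hk : 2 ≤ k) : Jord k :=
  ⟨marginalMul k hk, by
    constructor
    · intro x y; ext; simp [marginalMul]; ring
    · intro x y; ext; simp [marginalMul]; ring⟩

/-- The multiplication table of `𝔍_k`, with `e` the standard basis vector of index `0` and
`n₁, …, n_{k-1}` the others. -/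
theorem marginal_table (k : ℕ) (hk : 2 ≤ k) :
    let e : Vec k := Pi.single ⟨0, by omega⟩ 1
    let n : Fin k → Vec k := fun i => Pi.single i 1
    (marginal k hk).1 e e = e ∧
    (∀ i : Fin k, i.1 ≠ 0 → (marginal k hk).1 e (n i) = (1 / 2 : ℂ) • n i) ∧
    (∀ i j : Fin k, i.1 ≠ 0 → j.1 ≠ 0 → (marginal k hk).1 (n i) (n j) = 0) := by
  intro e n
  have h0 : ∀ i : Fin k, i.1 ≠ 0 → n i ⟨0, by omega⟩ = 0 := by
    intro i hi
    exact Pi.single_eq_of_ne (fun h => hi (by rw [← h])) _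
  have h1 : e ⟨0, by omega⟩ = 1 := Pi.single_eq_same _ _
  refine ⟨?_, ?_, ?_⟩
  · simp only [marginal, marginalMul, LinearMap.mk₂_apply, h1]
    module
  · intro i hi
    simp only [marginal, marginalMul, LinearMap.mk₂_apply, h0 i hi, h1]
    module
  · intro i j hi hj
    simp only [marginal, marginalMul, LinearMap.mk₂_apply, h0 i hi, h0 j hj]
    module

end JordVar

end

namespace JordVar

/-! The orbit of `𝔍_k` consists of the multiplications x y = (f(x) y + f(y) x) / 2 with f a nonzero
linear functional. Allowing f = 0 gives a linear, hence closed, subspace, so the closure of the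
orbit adds only 0: level one.

Rigidity needs an open condition forcing this form. Near a point of the orbit choose x with f(x) = 1
and ask that L_{x²} - L_x² + f ⊗ x be invertible and f(x²) ≠ 0. In a Jordan algebra L_{x²} - L_x²
kills x and x², and invertibility after a rank-one perturbation leaves it a kernel of dimension at
most one. So x² = c x with c ≠ 0, and u = x / c is an idempotent whose Peirce 0-space vanishes and
whose 1-space is the line of u; the remaining 1/2-space has zero product.

Orbits are irreducible, so an open orbit is dense in every component it meets and its closure is a
component. Components are cones, so all contain 0. As `nilSquare` lies outside the closure of the
orbit of `𝔍_k`, there is another component, and it misses that orbit; only 0 remains in the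
intersection. -/

variable {k : ℕ}

/-! ### Polynomial functions and the Zariski topology -/

/-- The algebra of functions on `AlgStr k` that are polynomial in the structure constants. -/
noncomputable def polyFun (k : ℕ) : Subalgebra ℂ (AlgStr k → ℂ) :=
  (MvPolynomial.aeval (R := ℂ) fun t (μ : AlgStr k) => structConst μ t).range

theorem mem_polyFun_iff {F : AlgStr k → ℂ} :
    F ∈ polyFun k ↔ ∃ p, ∀ μ, F μ = MvPolynomial.eval (structConst μ) p := by
  have h (p : MvPolynomial (Fin k × Fin k × Fin k) ℂ) (μ : AlgStr k) :
      MvPolynomial.aeval (R := ℂ) (fun t (μ : AlgStr k) => structConst μ t) p μ =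
        MvPolynomial.eval (structConst μ) p := by
    have := MvPolynomial.comp_aeval_apply (R := ℂ) (fun t (μ : AlgStr k) => structConst μ t)
      (Pi.evalAlgHom ℂ (fun _ : AlgStr k => ℂ) μ) p
    simpa [MvPolynomial.coe_aeval_eq_eval] using this
  constructor
  · rintro ⟨p, rfl⟩
    exact ⟨p, h p⟩
  · rintro ⟨p, hp⟩
    exact ⟨p, funext fun μ => (h p μ).trans (hp μ).symm⟩

theorem structConst_mem_polyFun (t : Fin k × Fin k × Fin k) :
    (fun μ : AlgStr k => structConst μ t) ∈ polyFun k :=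
  mem_polyFun_iff.2 ⟨MvPolynomial.X t, fun μ => by simp⟩

theorem apply_eq_sum_structConst (μ : AlgStr k) (x y : Vec k) (l : Fin k) :
    μ x y l = ∑ i, ∑ j, x i * y j * structConst μ (i, j, l) := by
  conv_lhs => rw [pi_eq_sum_univ' x, pi_eq_sum_univ' y]
  simp only [map_sum, map_smul, LinearMap.sum_apply, LinearMap.smul_apply, Finset.sum_apply,
    Pi.smul_apply, smul_eq_mul, structConst, Finset.mul_sum]
  rw [Finset.sum_comm]
  exact Finset.sum_congr rfl fun i _ => Finset.sum_congr rfl fun j _ => by ring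

theorem polyFun_comp {f : AlgStr k → AlgStr k}
    (hf : ∀ t, (fun μ => structConst (f μ) t) ∈ polyFun k) {F : AlgStr k → ℂ}
    (hF : F ∈ polyFun k) : F ∘ f ∈ polyFun k := by
  obtain ⟨p, hp⟩ := mem_polyFun_iff.1 hF
  choose q hq using fun t => mem_polyFun_iff.1 (hf t)
  refine mem_polyFun_iff.2 ⟨MvPolynomial.bind₁ q p, fun μ => ?_⟩
  have h : structConst (f μ) = fun t => MvPolynomial.eval (structConst μ) (q t) :=
    funext fun t => hq t μ
  rw [Function.comp_apply, hp, h]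
  exact (MvPolynomial.aeval_bind₁ (S := ℂ) (structConst μ) q p).symm

/-- Polynomial functions restrict to univariate polynomials on polynomially parametrized
curves. -/
theorem exists_polynomial_of_curve {γ : ℂ → AlgStr k}
    (hγ : ∀ t, ∃ q : Polynomial ℂ, ∀ s, structConst (γ s) t = q.eval s) {F : AlgStr k → ℂ}
    (hF : F ∈ polyFun k) : ∃ q : Polynomial ℂ, ∀ s, F (γ s) = q.eval s := by
  obtain ⟨p, hp⟩ := mem_polyFun_iff.1 hF
  choose q hq using hγ
  refine ⟨MvPolynomial.aeval q p, fun s => ?_⟩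
  have := MvPolynomial.comp_aeval_apply (R := ℂ) q (Polynomial.aeval s) p
  rw [hp, ← Polynomial.coe_aeval_eq_eval, this]
  simp [funext fun t => hq t s]

theorem isOpen_ne_zero {F : AlgStr k → ℂ} (hF : F ∈ polyFun k) :
    IsOpen {ν : Jord k | F ν.1 ≠ 0} := by
  obtain ⟨p, hp⟩ := mem_polyFun_iff.1 hF
  let _ := zariskiTopology k
  have : IsClosed (zeroSet {p}) := by
    refine ⟨?_⟩
    exact ⟨{p}, compl_compl _⟩
  refine isOpen_induced_iff.2 ⟨(zeroSet {p})ᶜ, this.isOpen_compl, ?_⟩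
  ext ν
  simp only [zeroSet, Set.mem_singleton_iff, forall_eq, hp]
  rfl

theorem exists_polyFun_of_isOpen {U : Set (Jord k)} (hU : IsOpen U) {ν : Jord k} (hν : ν ∈ U) :
    ∃ F ∈ polyFun k, F ν.1 ≠ 0 ∧ ∀ ρ : Jord k, F ρ.1 ≠ 0 → ρ ∈ U := by
  let _ := zariskiTopology k
  obtain ⟨T, hT, rfl⟩ := isOpen_induced_iff.1 hU
  have : ∃ S, Tᶜ = zeroSet S := by
    exact hT
  obtain ⟨S, hS⟩ := this
  have h : ν.1 ∉ zeroSet S := by rw [← hS]; exact fun h => h hν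
  simp only [zeroSet, Set.mem_ofPred_eq, not_forall] at h
  obtain ⟨p, hp, hne⟩ := h
  refine ⟨fun μ => MvPolynomial.eval (structConst μ) p, mem_polyFun_iff.2 ⟨p, fun _ => rfl⟩, hne,
    fun ρ hρ => ?_⟩
  by_contra hc
  have : ρ.1 ∈ zeroSet S := by rw [← hS]; exact hc
  exact hρ (this p hp)

/-- Nonvanishing loci of polynomial functions form a basis of the topology, so a closure is the zero
locus of its vanishing ideal. -/
theorem mem_closure_iff_polyFun {s : Set (Jord k)} {ν : Jord k} :
    ν ∈ closure s ↔ ∀ F ∈ polyFun k, (∀ ρ ∈ s, F ρ.1 = 0) → F ν.1 = 0 := by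
  rw [mem_closure_iff]
  constructor
  · intro h F hF hs
    by_contra hne
    obtain ⟨ρ, h1, h2⟩ := h _ (isOpen_ne_zero hF) hne
    exact h1 (hs ρ h2)
  · intro h U hU hν
    obtain ⟨F, hF, hne, hFU⟩ := exists_polyFun_of_isOpen hU hν
    by_contra hc
    refine hne (h F hF fun ρ hρ => ?_)
    by_contra hρ0
    exact hc ⟨ρ, hFU ρ hρ0, hρ⟩

theorem apply_mem_polyFun (x y : Vec k) (l : Fin k) : (fun μ : AlgStr k => μ x y l) ∈ polyFun k := by
  have : (fun μ : AlgStr k => μ x y l) =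
      ∑ i, ∑ j, (x i * y j) • (fun μ : AlgStr k => structConst μ (i, j, l)) := by
    funext μ
    simp [apply_eq_sum_structConst, Finset.sum_apply]
  rw [this]
  exact sum_mem fun i _ => sum_mem fun j _ =>
    Subalgebra.smul_mem _ (structConst_mem_polyFun _) _

/-! ### Scaling -/

theorem IsJordanMul.smul {μ : AlgStr k} (h : IsJordanMul μ) (t : ℂ) : IsJordanMul (t • μ) := by
  constructor
  · intro x y
    rw [LinearMap.smul_apply, LinearMap.smul_apply, LinearMap.smul_apply, LinearMap.smul_apply,
      h.1 x y]
  · intro x y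
    simp only [LinearMap.smul_apply, map_smul, h.2 x y]

/-- The multiplication `t μ`. -/
def scale (t : ℂ) (μ : Jord k) : Jord k := ⟨t • μ.1, μ.2.smul t⟩

theorem scale_zero (μ : Jord k) : scale 0 μ = 0 := Subtype.ext (zero_smul ℂ μ.1)

theorem scale_one (μ : Jord k) : scale 1 μ = μ := Subtype.ext (one_smul ℂ μ.1)

theorem exists_polynomial_scale (μ : AlgStr k) {F : AlgStr k → ℂ} (hF : F ∈ polyFun k) :
    ∃ q : Polynomial ℂ, ∀ s : ℂ, F (s • μ) = q.eval s :=
  exists_polynomial_of_curve (γ := fun s => s • μ)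
    (fun t => ⟨Polynomial.C (structConst μ t) * Polynomial.X, fun s => by
      rw [Polynomial.eval_mul, Polynomial.eval_C, Polynomial.eval_X, mul_comm]
      rfl⟩) hF

theorem isOpen_preimage_scale (t : ℂ) {F : AlgStr k → ℂ} (hF : F ∈ polyFun k) :
    IsOpen {ν : Jord k | F (t • ν.1) ≠ 0} :=
  isOpen_ne_zero (polyFun_comp (f := fun μ => t • μ)
    (fun s => Subalgebra.smul_mem _ (structConst_mem_polyFun s) t) hF)

theorem orbit_self (μ : Jord k) : μ ∈ orbit μ := ⟨LinearEquiv.refl ℂ _, fun _ _ => rfl⟩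

theorem orbit_subset {μ ν : Jord k} (h : ν ∈ orbit μ) : orbit ν ⊆ orbit μ := by
  obtain ⟨g, hg⟩ := h
  rintro ρ ⟨f, hf⟩
  exact ⟨g.trans f, fun x y => by simp [hf, hg]⟩

theorem orbit_symm {μ ν : Jord k} (h : ν ∈ orbit μ) : μ ∈ orbit ν := by
  obtain ⟨g, hg⟩ := h
  exact ⟨g.symm, fun x y => by simp [hg]⟩

theorem orbit_eq {μ ν : Jord k} (h : ν ∈ orbit μ) : orbit ν = orbit μ :=
  (orbit_subset h).antisymm (orbit_subset (orbit_symm h))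

/-- The homothety by t⁻¹ does it: one factor t⁻¹ outside, two factors t inside. -/
theorem scale_mem_orbit {t : ℂ} (ht : t ≠ 0) (μ : Jord k) : scale t μ ∈ orbit μ := by
  refine ⟨(LinearEquiv.smulOfNeZero ℂ (Vec k) t ht).symm, fun x y => ?_⟩
  rw [LinearEquiv.eq_symm_apply]
  simp [scale, smul_smul]

theorem orbit_zero : orbit (0 : Jord k) = {0} := by
  refine Set.eq_singleton_iff_unique_mem.2 ⟨orbit_self 0, ?_⟩
  rintro ν ⟨g, hg⟩
  refine Subtype.ext (LinearMap.ext fun x => LinearMap.ext fun y => ?_)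
  rw [hg]
  exact map_zero g

theorem polynomial_eq_zero_of_eval {q : Polynomial ℂ} (h : ∀ s ≠ 0, q.eval s = 0) : q = 0 := by
  have : Polynomial.X * q = 0 := Polynomial.funext fun s => by
    by_cases hs : s = 0 <;> simp [hs, h]
  exact (mul_eq_zero.1 this).resolve_left Polynomial.X_ne_zero

theorem zero_mem_closure_orbit (μ : Jord k) : 0 ∈ closure (orbit μ) := by
  refine mem_closure_iff_polyFun.2 fun F hF h => ?_
  obtain ⟨q, hq⟩ := exists_polynomial_scale μ.1 hF
  have : q = 0 := polynomial_eq_zero_of_eval fun s hs => by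
    rw [← hq]; exact h _ (scale_mem_orbit hs μ)
  have h0 := hq 0
  rw [this, zero_smul] at h0
  exact h0.trans Polynomial.eval_zero

theorem closure_singleton_zero : closure {(0 : Jord k)} = {0} := by
  refine Set.Subset.antisymm (fun ν hν => Subtype.ext ?_) subset_closure
  refine LinearMap.ext fun x => LinearMap.ext fun y => funext fun l => ?_
  exact mem_closure_iff_polyFun.1 hν _ (apply_mem_polyFun x y l) fun ρ hρ => by
    rw [Set.mem_singleton_iff.1 hρ]; rfl

/-- Every irreducible component is a cone. -/
theorem zero_mem_of_mem_irreducibleComponents {C : Set (Jord k)}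
    (hC : C ∈ irreducibleComponents (Jord k)) : 0 ∈ C := by
  have hirr : IsIrreducible C := hC.1
  -- The cone over C is again irreducible, so maximality of C gives T ⊆ C, and 0 ∈ T.
  let T : Set (Jord k) := {ρ | ∃ t : ℂ, ∃ ν ∈ C, ρ = scale t ν}
  have hCT : C ⊆ T := fun ν hν => ⟨1, ν, hν, (scale_one ν).symm⟩
  have hT : IsIrreducible T := by
    refine ⟨hirr.1.mono hCT, ?_⟩
    rintro U V hU hV ⟨_, ⟨t₁, ν₁, hν₁, rfl⟩, h₁⟩ ⟨_, ⟨t₂, ν₂, hν₂, rfl⟩, h₂⟩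
    obtain ⟨F, hF, hF0, hFU⟩ := exists_polyFun_of_isOpen hU h₁
    obtain ⟨G, hG, hG0, hGV⟩ := exists_polyFun_of_isOpen hV h₂
    obtain ⟨p, hp⟩ := exists_polynomial_scale ν₁.1 hF
    obtain ⟨q, hq⟩ := exists_polynomial_scale ν₂.1 hG
    have hp0 : p ≠ 0 := fun h => hF0 ((hp t₁).trans (by simp [h]))
    have hq0 : q ≠ 0 := fun h => hG0 ((hq t₂).trans (by simp [h]))
    -- One t serves both open sets, which reduces the claim to irreducibility of C itself.
    obtain ⟨t, ht⟩ : ∃ t, (p * q).eval t ≠ 0 := by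
      by_contra! h
      exact mul_ne_zero hp0 hq0 (Polynomial.funext fun s => by simpa using h s)
    rw [Polynomial.eval_mul, mul_ne_zero_iff] at ht
    obtain ⟨ρ, hρC, hρF, hρG⟩ := hirr.2 _ _ (isOpen_preimage_scale t hF)
      (isOpen_preimage_scale t hG) ⟨ν₁, hν₁, show F _ ≠ 0 from hp t ▸ ht.1⟩
      ⟨ν₂, hν₂, show G _ ≠ 0 from hq t ▸ ht.2⟩
    exact ⟨scale t ρ, ⟨t, ρ, hρC, rfl⟩, hFU _ hρF, hGV _ hρG⟩
  obtain ⟨ν, hν⟩ := hirr.1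
  exact hC.2 hT hCT ⟨0, ν, hν, (scale_zero ν).symm⟩

/-! ### Irreducibility of orbits -/

/-- The multiplication `g * μ`. -/
def act (g : Vec k ≃ₗ[ℂ] Vec k) (μ : Jord k) : Jord k :=
  ⟨(μ.1.compl₁₂ g.symm.toLinearMap g.symm.toLinearMap).compr₂ g.toLinearMap, by
    refine ⟨fun x y => ?_, fun x y => ?_⟩
    · simp [μ.2.1 (g.symm x) (g.symm y)]
    · simp [μ.2.2 (g.symm x) (g.symm y)]⟩

theorem act_mem_orbit (g : Vec k ≃ₗ[ℂ] Vec k) (μ : Jord k) : act g μ ∈ orbit μ :=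
  ⟨g, fun _ _ => rfl⟩

/-- The multiplication `(x, y) ↦ c h (μ (adj(h) x, adj(h) y))`. -/
noncomputable def adjTwist (μ : AlgStr k) (c : ℂ) (h : Matrix (Fin k) (Fin k) ℂ) : AlgStr k :=
  c • ((μ.compl₁₂ (Matrix.toLin' h.adjugate) (Matrix.toLin' h.adjugate)).compr₂ (Matrix.toLin' h))

/-- Using the adjugate in place of h⁻¹ makes the constants polynomial in c and the entries of h. The
extra factor det(h)² is harmless, since nonzero scaling stays in the orbit. -/
theorem structConst_adjTwist (μ : AlgStr k) (c : ℂ) (h : Matrix (Fin k) (Fin k) ℂ)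
    (t : Fin k × Fin k × Fin k) :
    structConst (adjTwist μ c h) t = c * ∑ l, h t.2.2 l * ∑ i, ∑ j,
      h.adjugate i t.1 * h.adjugate j t.2.1 * structConst μ (i, j, l) := by
  change c * (h.mulVec (μ (h.adjugate.mulVec (Pi.single t.1 1))
    (h.adjugate.mulVec (Pi.single t.2.1 1)))) t.2.2 = _
  simp only [Matrix.mulVec, dotProduct, apply_eq_sum_structConst μ]
  simp [Pi.single_apply]

theorem adjTwist_mem_orbit (μ : Jord k) {c : ℂ} (hc : c ≠ 0) {h : Matrix (Fin k) (Fin k) ℂ}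
    (hh : h.det ≠ 0) : ∃ ν ∈ orbit μ, ν.1 = adjTwist μ.1 c h := by
  have h1 : h * h⁻¹ = 1 := Matrix.mul_nonsing_inv _ (isUnit_iff_ne_zero.2 hh)
  have h2 : h⁻¹ * h = 1 := Matrix.nonsing_inv_mul _ (isUnit_iff_ne_zero.2 hh)
  let g : Vec k ≃ₗ[ℂ] Vec k := LinearEquiv.ofLinearMap (Matrix.toLin' h) (Matrix.toLin' h⁻¹)
    (by rw [← Matrix.toLin'_mul, h1, Matrix.toLin'_one])
    (by rw [← Matrix.toLin'_mul, h2, Matrix.toLin'_one])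
  have hadj : h.adjugate = h.det • h⁻¹ := by
    rw [Matrix.inv_def, smul_smul, Ring.mul_inverse_cancel _ (isUnit_iff_ne_zero.2 hh), one_smul]
  refine ⟨scale (c * h.det ^ 2) (act g μ), orbit_subset (act_mem_orbit g μ)
    (scale_mem_orbit (mul_ne_zero hc (pow_ne_zero 2 hh)) _), ?_⟩
  refine LinearMap.ext fun x => LinearMap.ext fun y => ?_
  have hg (z : Vec k) : g z = Matrix.toLin' h z := rfl
  have hg' (z : Vec k) : g.symm z = Matrix.toLin' h⁻¹ z := rfl
  change (c * h.det ^ 2) • g (μ.1 (g.symm x) (g.symm y)) =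
    c • Matrix.toLin' h (μ.1 (Matrix.toLin' h.adjugate x) (Matrix.toLin' h.adjugate y))
  rw [hadj, map_smul, hg, hg', hg']
  simp only [LinearMap.smul_apply, map_smul, smul_smul]
  ring_nf

theorem exists_adjTwist_of_mem_orbit {μ ν : Jord k} (h : ν ∈ orbit μ) :
    ∃ c : ℂ, c ≠ 0 ∧ ∃ h : Matrix (Fin k) (Fin k) ℂ, h.det ≠ 0 ∧ ν.1 = adjTwist μ.1 c h := by
  obtain ⟨g, hg⟩ := h
  let h := LinearMap.toMatrix' g.toLinearMap
  let h' := LinearMap.toMatrix' g.symm.toLinearMap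
  have h1 : h * h' = 1 := by rw [← LinearMap.toMatrix'_comp]; simp
  have h2 : h' * h = 1 := by rw [← LinearMap.toMatrix'_comp]; simp
  have hdet : h.det ≠ 0 := left_ne_zero_of_mul_eq_one (by rw [← Matrix.det_mul, h1, Matrix.det_one])
  have hadj : h.adjugate = h.det • h' := by
    rw [← mul_one h.adjugate, ← h1, ← mul_assoc, Matrix.adjugate_mul, Matrix.smul_mul, one_mul]
  refine ⟨(h.det ^ 2)⁻¹, inv_ne_zero (pow_ne_zero 2 hdet), h, hdet, ?_⟩
  refine LinearMap.ext fun x => LinearMap.ext fun y => ?_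
  change _ = (h.det ^ 2)⁻¹ •
    Matrix.toLin' h (μ.1 (Matrix.toLin' h.adjugate x) (Matrix.toLin' h.adjugate y))
  rw [hadj, map_smul, Matrix.toLin'_toMatrix', Matrix.toLin'_toMatrix', hg]
  simp only [LinearMap.smul_apply, map_smul, smul_smul, LinearEquiv.coe_coe]
  rw [show (h.det ^ 2)⁻¹ * (h.det * h.det) = 1 by field_simp, one_smul]

/-- Along a line in the space of pairs `(c, h)`, `adjTwist` is polynomial. -/
theorem exists_polynomial_adjTwist (μ : AlgStr k) (c₁ c₂ : ℂ) (h₁ h₂ : Matrix (Fin k) (Fin k) ℂ)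
    {F : AlgStr k → ℂ} (hF : F ∈ polyFun k) : ∃ q : Polynomial ℂ, ∀ s : ℂ,
      F (adjTwist μ (c₁ + s * (c₂ - c₁)) (h₁ + s • (h₂ - h₁))) = q.eval s := by
  refine exists_polynomial_of_curve (fun t => ?_) hF
  let H : Matrix (Fin k) (Fin k) (Polynomial ℂ) :=
    fun i j => Polynomial.C (h₁ i j) + Polynomial.X * Polynomial.C (h₂ i j - h₁ i j)
  have hH (s : ℂ) : (Polynomial.evalRingHom s).mapMatrix H = h₁ + s • (h₂ - h₁) := by
    ext i j
    change (H i j).eval s = _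
    simp [H]
  refine ⟨(Polynomial.C c₁ + Polynomial.X * Polynomial.C (c₂ - c₁)) * ∑ l, H t.2.2 l * ∑ i, ∑ j,
      H.adjugate i t.1 * H.adjugate j t.2.1 * Polynomial.C (structConst μ (i, j, l)), fun s => ?_⟩
  rw [structConst_adjTwist, ← hH, ← RingHom.map_adjugate]
  simp [Polynomial.eval_finsetSum]

theorem exists_polynomial_det (h₁ h₂ : Matrix (Fin k) (Fin k) ℂ) :
    ∃ q : Polynomial ℂ, ∀ s : ℂ, (h₁ + s • (h₂ - h₁)).det = q.eval s := by
  refine ⟨(h₁.map Polynomial.C +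
    (Polynomial.X : Polynomial ℂ) • (h₂ - h₁).map Polynomial.C).det, fun s => ?_⟩
  rw [← Polynomial.coe_evalRingHom, RingHom.map_det]
  congr 1
  ext i j
  simp

/-- Two orbit points are joined by a line of pairs (c, h). On it F, G, the determinant and c are
nonzero polynomials in s, hence have a common non-root. -/
theorem isIrreducible_orbit (μ : Jord k) : IsIrreducible (orbit μ) := by
  refine ⟨⟨μ, orbit_self μ⟩, ?_⟩
  rintro U V hU hV ⟨ν₁, hν₁, h₁⟩ ⟨ν₂, hν₂, h₂⟩
  obtain ⟨F, hF, hF0, hFU⟩ := exists_polyFun_of_isOpen hU h₁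
  obtain ⟨G, hG, hG0, hGV⟩ := exists_polyFun_of_isOpen hV h₂
  obtain ⟨c₁, hc₁, g₁, hg₁, e₁⟩ := exists_adjTwist_of_mem_orbit hν₁
  obtain ⟨c₂, hc₂, g₂, hg₂, e₂⟩ := exists_adjTwist_of_mem_orbit hν₂
  obtain ⟨p, hp⟩ := exists_polynomial_adjTwist μ.1 c₁ c₂ g₁ g₂ hF
  obtain ⟨q, hq⟩ := exists_polynomial_adjTwist μ.1 c₁ c₂ g₁ g₂ hG
  obtain ⟨d, hd⟩ := exists_polynomial_det g₁ g₂
  let r : Polynomial ℂ := Polynomial.C c₁ + Polynomial.X * Polynomial.C (c₂ - c₁)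
  have hr (s : ℂ) : r.eval s = c₁ + s * (c₂ - c₁) := by simp [r]
  have hp0 : p ≠ 0 := fun h => hF0 (by have := hp 0; simpa [h, ← e₁] using this)
  have hq0 : q ≠ 0 := fun h => hG0 (by have := hq 1; simpa [h, ← e₂] using this)
  have hd0 : d ≠ 0 := fun h => hg₁ (by have := hd 0; simpa [h] using this)
  have hr0 : r ≠ 0 := fun h => hc₁ (by have := hr 0; simpa [h] using this.symm)
  obtain ⟨s, hs⟩ : ∃ s, (p * q * (d * r)).eval s ≠ 0 := by
    by_contra! h
    exact mul_ne_zero (mul_ne_zero hp0 hq0) (mul_ne_zero hd0 hr0)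
      (Polynomial.funext fun s => by simpa using h s)
  simp only [Polynomial.eval_mul, mul_ne_zero_iff, ← hp, ← hq, ← hd, hr] at hs
  obtain ⟨ν, hν, e⟩ := adjTwist_mem_orbit μ hs.2.2 hs.2.1
  rw [← e] at hs
  exact ⟨ν, hν, hFU _ hs.1.1, hGV _ hs.1.2⟩

theorem closure_orbit_mem_irreducibleComponents {μ : Jord k} (h : IsRigid μ) :
    closure (orbit μ) ∈ irreducibleComponents (Jord k) := by
  refine ⟨(isIrreducible_orbit μ).closure, fun C hC hle => ?_⟩
  have hμ : μ ∈ C := hle (subset_closure (orbit_self μ))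
  intro ν hν
  refine mem_closure_iff.2 fun U hU hνU => ?_
  -- The open orbit meets the irreducible set C, so it is dense in C.
  obtain ⟨ρ, -, h1, h2⟩ := hC.2 U (orbit μ) hU h ⟨ν, hν, hνU⟩ ⟨μ, hμ, orbit_self μ⟩
  exact ⟨ρ, h1, h2⟩

/-- An irreducible component meeting an open orbit is the closure of that orbit. -/
theorem eq_closure_orbit_of_mem {μ ν : Jord k} (h : IsRigid μ) (hν : ν ∈ orbit μ)
    {C : Set (Jord k)} (hC : C ∈ irreducibleComponents (Jord k)) (hνC : ν ∈ C) :
    C = closure (orbit μ) := by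
  have hle : C ⊆ closure (orbit μ) := fun ρ hρ => mem_closure_iff.2 fun U hU hρU => by
    obtain ⟨σ, -, h1, h2⟩ := hC.1.2 U (orbit μ) hU h ⟨ρ, hρ, hρU⟩ ⟨ν, hνC, hν⟩
    exact ⟨σ, h1, h2⟩
  exact hle.antisymm (hC.2 (isIrreducible_orbit μ).closure hle)

/-! ### Degenerations and level one -/

/-- Every neighbourhood of 0 meets every orbit. -/
theorem not_isRigid_zero_of_ne {μ : Jord k} (hμ : μ ≠ 0) : ¬ IsRigid (0 : Jord k) := by
  intro h
  obtain ⟨ν, h1, h2⟩ := mem_closure_iff.1 (zero_mem_closure_orbit μ) _ h (orbit_self 0)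
  rw [orbit_zero] at h1
  rw [Set.mem_singleton_iff.1 h1] at h2
  have := orbit_symm h2
  rw [orbit_zero] at this
  exact hμ this

theorem properDegeneration_zero {μ : Jord k} (hμ : μ ≠ 0) : ProperDegeneration μ 0 := by
  refine ⟨zero_mem_closure_orbit μ, fun h => hμ ?_⟩
  have := orbit_symm h
  rwa [orbit_zero] at this

theorem not_properDegeneration_of_zero (ν : Jord k) : ¬ ProperDegeneration 0 ν := by
  rintro ⟨h1, h2⟩
  rw [Degenerates, orbit_zero, closure_singleton_zero] at h1
  exact h2 (orbit_zero ▸ h1)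

/-- Any further ν in the closure would give a chain μ → ν → 0 of length two. -/
theorem closure_orbit_eq_of_level_eq_one {μ : Jord k} (h : level μ = 1) :
    closure (orbit μ) = orbit μ ∪ {0} := by
  refine Set.Subset.antisymm (fun ν hν => ?_) (Set.union_subset subset_closure
    (Set.singleton_subset_iff.2 (zero_mem_closure_orbit μ)))
  by_contra hc
  rw [Set.mem_union, not_or, Set.mem_singleton_iff] at hc
  let c : RelSeries {p : Jord k × Jord k | ProperDegeneration p.1 p.2} :=
    ((RelSeries.singleton _ (0 : Jord k)).cons ν (properDegeneration_zero hc.2)).cons μ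
      (show ProperDegeneration _ _ from by simpa using ⟨hν, hc.1⟩)
  have hle : ((c.length : ℕ) : ℕ∞) ≤ level μ :=
    le_iSup₂ (f := fun (c : RelSeries {p : Jord k × Jord k | ProperDegeneration p.1 p.2})
      (_ : c.head = μ) => (c.length : ℕ∞)) c (RelSeries.head_cons _ _ _)
  rw [h] at hle
  have : c.length = 2 := rfl
  rw [this] at hle
  norm_num at hle

theorem level_eq_one_of_closure_orbit_eq {μ : Jord k} (hμ : μ ≠ 0)
    (h : closure (orbit μ) = orbit μ ∪ {0}) : level μ = 1 := by
  refine le_antisymm (iSup₂_le fun c hc => ?_) ?_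
  · by_contra! hlt
    have h2 : 2 ≤ c.length := by
      have : 1 < c.length := by exact_mod_cast hlt
      exact this
    have s0 : ProperDegeneration _ _ := c.step ⟨0, by omega⟩
    have s1 : ProperDegeneration _ _ := c.step ⟨1, by omega⟩
    have e0 : c (Fin.castSucc ⟨0, by omega⟩) = μ := hc
    have e1 : c (Fin.succ ⟨0, by omega⟩) = 0 := by
      obtain ⟨a, b⟩ := s0
      rw [Degenerates, e0, h] at a
      rw [e0] at b
      exact a.resolve_left b
    exact not_properDegeneration_of_zero _ (e1 ▸ s1)
  · exact le_iSup₂ (f := fun (c : RelSeries {p : Jord k × Jord k | ProperDegeneration p.1 p.2})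
      (_ : c.head = μ) => (c.length : ℕ∞))
      ((RelSeries.singleton _ (0 : Jord k)).cons μ (properDegeneration_zero hμ))
      (RelSeries.head_cons _ _ _)

/-! ### The algebras attached to linear functionals -/

/-- The multiplication `x y = (f(x) y + f(y) x) / 2`. -/
noncomputable def dualMul (f : Vec k →ₗ[ℂ] ℂ) : AlgStr k :=
  LinearMap.mk₂ ℂ (fun x y => (1 / 2 : ℂ) • (f x • y + f y • x))
    (by intros; simp only [map_add]; module) (by intros; simp only [map_smul, smul_eq_mul]; module)
    (by intros; simp only [map_add]; module) (by intros; simp only [map_smul, smul_eq_mul]; module)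

theorem dualMul_apply (f : Vec k →ₗ[ℂ] ℂ) (x y : Vec k) :
    dualMul f x y = (1 / 2 : ℂ) • (f x • y + f y • x) := rfl

theorem dualMul_zero : dualMul (0 : Vec k →ₗ[ℂ] ℂ) = 0 := by
  ext x y l
  simp [dualMul_apply]

theorem marginal_eq_dualMul (hk : 2 ≤ k) :
    (marginal k hk).1 = dualMul (LinearMap.proj ⟨0, by omega⟩) := rfl

theorem exists_linearEquiv_comp_eq {V : Type*} [AddCommGroup V] [Module ℂ V] {f g : V →ₗ[ℂ] ℂ}
    (hf : f ≠ 0) (hg : g ≠ 0) : ∃ T : V ≃ₗ[ℂ] V, ∀ y, f (T y) = g y := by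
  obtain ⟨x, hfx, hgx⟩ : ∃ x, f x ≠ 0 ∧ g x ≠ 0 := by
    obtain ⟨a, ha⟩ := DFunLike.ne_iff.1 hf
    obtain ⟨b, hb⟩ := DFunLike.ne_iff.1 hg
    rw [LinearMap.zero_apply] at ha hb
    by_cases h1 : g a = 0
    · by_cases h2 : f b = 0
      · exact ⟨a + b, by simpa [h2] using ha, by simpa [h1] using hb⟩
      · exact ⟨b, h2, hb⟩
    · exact ⟨a, ha, h1⟩
  -- Shear along x, correcting f by g - f; exchanging f and g gives the inverse.
  refine ⟨LinearEquiv.ofLinearMap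
    (LinearMap.id + (((f x)⁻¹ • (g - f)).smulRight x))
    (LinearMap.id + (((g x)⁻¹ • (f - g)).smulRight x)) ?_ ?_, fun y => ?_⟩
  · refine LinearMap.ext fun y => ?_
    simp only [LinearMap.comp_apply, LinearMap.add_apply, LinearMap.id_apply,
      LinearMap.smulRight_apply, LinearMap.smul_apply, LinearMap.sub_apply, map_add, map_smul,
      smul_eq_mul]
    match_scalars
    · ring
    · field_simp
      ring
  · refine LinearMap.ext fun y => ?_
    simp only [LinearMap.comp_apply, LinearMap.add_apply, LinearMap.id_apply,
      LinearMap.smulRight_apply, LinearMap.smul_apply, LinearMap.sub_apply, map_add, map_smul,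
      smul_eq_mul]
    match_scalars
    · ring
    · field_simp
      ring
  · simp
    field_simp
    ring

theorem proj_ne_zero (i : Fin k) : (LinearMap.proj i : Vec k →ₗ[ℂ] ℂ) ≠ 0 := by
  intro h
  have := LinearMap.congr_fun h (Pi.single i 1)
  simp at this

/-- The group acts by f ↦ f ∘ g⁻¹, transitively on nonzero functionals. -/
theorem mem_orbit_marginal_iff (hk : 2 ≤ k) {ν : Jord k} :
    ν ∈ orbit (marginal k hk) ↔ ∃ f : Vec k →ₗ[ℂ] ℂ, f ≠ 0 ∧ ν.1 = dualMul f := by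
  constructor
  · rintro ⟨g, hg⟩
    refine ⟨(LinearMap.proj ⟨0, by omega⟩).comp g.symm.toLinearMap, fun h => ?_, ?_⟩
    · refine proj_ne_zero (⟨0, by omega⟩ : Fin k) (LinearMap.ext fun x => ?_)
      have := LinearMap.congr_fun h (g x)
      simpa using this
    · refine LinearMap.ext fun x => LinearMap.ext fun y => ?_
      rw [hg, marginal_eq_dualMul, dualMul_apply, dualMul_apply]
      simp
  · rintro ⟨f, hf, e⟩
    obtain ⟨T, hT⟩ := exists_linearEquiv_comp_eq hf (proj_ne_zero (⟨0, by omega⟩ : Fin k))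
    refine ⟨T, fun x y => ?_⟩
    have h (x : Vec k) : (LinearMap.proj ⟨0, by omega⟩ : Vec k →ₗ[ℂ] ℂ) (T.symm x) = f x := by
      rw [← hT, T.apply_symm_apply]
    rw [e, marginal_eq_dualMul, dualMul_apply, dualMul_apply, h, h]
    simp

theorem marginal_ne_zero (hk : 2 ≤ k) : marginal k hk ≠ 0 := by
  intro h
  have h1 := (marginal_table k hk).1
  rw [h] at h1
  have := congrFun h1 ⟨0, by omega⟩
  exact zero_ne_one (this.trans (Pi.single_eq_same _ _))

/-- The multiplications `dualMul f` form a linear subspace, which is Zariski closed. -/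
theorem exists_dualMul_of_mem_closure {s : Set (Jord k)}
    (hs : ∀ ρ ∈ s, ∃ f, ρ.1 = dualMul f) {ν : Jord k} (hν : ν ∈ closure s) :
    ∃ f, ν.1 = dualMul f := by
  -- Since eᵢ² = f(eᵢ) eᵢ, the diagonal constants recover f linearly, so being of the form `dualMul
  -- f` is a system of linear equations.
  let φ : AlgStr k → Fin k → ℂ := fun μ i => μ (Pi.single i 1) (Pi.single i 1) i
  have hφ (f : Vec k →ₗ[ℂ] ℂ) (i : Fin k) : φ (dualMul f) i = f (Pi.single i 1) := by
    simp [φ, dualMul_apply]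
    ring
  refine ⟨Fintype.linearCombination ℂ (φ ν.1), LinearMap.ext fun x => LinearMap.ext fun y =>
    funext fun l => ?_⟩
  rw [← sub_eq_zero]
  refine mem_closure_iff_polyFun.1 hν (fun μ => μ x y l -
    dualMul (Fintype.linearCombination ℂ (φ μ)) x y l) ?_ fun ρ hρ => ?_
  · have : (fun μ : AlgStr k => dualMul (Fintype.linearCombination ℂ (φ μ)) x y l) =
      (1 / 2 : ℂ) • ((∑ i, (y l * x i) • fun μ => φ μ i) + ∑ i, (x l * y i) • fun μ => φ μ i) := by
      funext μ
      simp [dualMul_apply, Fintype.linearCombination_apply, Finset.mul_sum,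
        mul_comm, mul_left_comm,
        mul_assoc]
    refine sub_mem (apply_mem_polyFun x y l) ?_
    rw [this]
    exact Subalgebra.smul_mem _ (add_mem
      (sum_mem fun i _ => Subalgebra.smul_mem _ (apply_mem_polyFun _ _ _) _)
      (sum_mem fun i _ => Subalgebra.smul_mem _ (apply_mem_polyFun _ _ _) _)) _
  · obtain ⟨f, hf⟩ := hs ρ hρ
    have : Fintype.linearCombination ℂ (φ ρ.1) = f := by
      refine LinearMap.pi_ext' fun i => LinearMap.ext_ring ?_
      simp [Fintype.linearCombination_apply, hf, hφ, Pi.single_apply]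
    change ρ.1 x y l - dualMul (Fintype.linearCombination ℂ (φ ρ.1)) x y l = 0
    rw [this, hf, sub_self]

theorem closure_orbit_marginal (hk : 2 ≤ k) :
    closure (orbit (marginal k hk)) = orbit (marginal k hk) ∪ {0} := by
  refine Set.Subset.antisymm (fun ν hν => ?_) (Set.union_subset subset_closure
    (Set.singleton_subset_iff.2 (zero_mem_closure_orbit _)))
  obtain ⟨f, hf⟩ := exists_dualMul_of_mem_closure
    (fun ρ hρ => ((mem_orbit_marginal_iff hk).1 hρ).imp fun f h => h.2) hν
  by_cases h : f = 0
  · exact Or.inr (Subtype.ext (hf.trans (h ▸ dualMul_zero)))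
  · exact Or.inl ((mem_orbit_marginal_iff hk).2 ⟨f, h, hf⟩)

/-! ### Rigidity -/

/-- The linearized Jordan identity. -/
theorem IsJordanMul.linearized {μ : AlgStr k} (h : IsJordanMul μ) (x y z : Vec k) :
    (2 : ℂ) • μ (μ (μ x z) y) x + μ (μ (μ x x) y) z =
      (2 : ℂ) • μ (μ x z) (μ y x) + μ (μ x x) (μ y z) := by
  have h1 := h.2 (x + z) y
  have h2 := h.2 (x - z) y
  have h3 := h.2 z y
  simp only [map_add, map_sub, LinearMap.add_apply, LinearMap.sub_apply, h.1 z x] at h1 h2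
  -- Half the difference at x ± z keeps the terms odd in z; the instance at z removes the cubic one.
  linear_combination (norm := module) (1 / 2 : ℂ) • h1 - (1 / 2 : ℂ) • h2 - h3

/-- An idempotent `u` for which `L_u² - L_u` has kernel spanned by `u` determines the
multiplication. -/
theorem eq_dualMul_of_idempotent {μ : AlgStr k} (h : IsJordanMul μ) {u : Vec k} (hu0 : u ≠ 0)
    (hu : μ u u = u) (hker : ∀ y, μ u (μ u y) = μ u y → ∃ c : ℂ, y = c • u) :
    ∃ f : Vec k →ₗ[ℂ] ℂ, f ≠ 0 ∧ μ = dualMul f := by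
  -- The Peirce relation 2L³ - 3L² + L = 0 for L = L_u.
  have hcube (z : Vec k) : (2 : ℂ) • μ u (μ u (μ u z)) + μ u z = (3 : ℂ) • μ u (μ u z) := by
    have := h.linearized u u z
    rw [hu, hu, h.1 (μ u z) u, h.1 (μ u (μ u z)) u] at this
    linear_combination (norm := module) this
  -- (L² - L)(2L - 1) = 0, so the range of 2L - 1 lies in the line of u.
  have hex (y : Vec k) : ∃ c : ℂ, (2 : ℂ) • μ u y - y = c • u := by
    refine hker _ ?_
    have := hcube y
    simp only [map_sub, LinearMap.map_smul]
    linear_combination (norm := module) this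
  let f : Vec k →ₗ[ℂ] ℂ := by
    exact (LinearEquiv.toSpanNonzeroSingleton ℂ (Vec k) u hu0).symm.toLinearMap ∘ₗ
      LinearMap.codRestrict (Submodule.span ℂ {u}) ((2 : ℂ) • μ u - LinearMap.id) (fun y => by
        obtain ⟨c, hc⟩ := hex y
        exact Submodule.mem_span_singleton.2 ⟨c, hc.symm⟩)
  have hf (y : Vec k) : (2 : ℂ) • μ u y - y = f y • u := by
    obtain ⟨c, hc⟩ := hex y
    exact (congrArg Subtype.val ((LinearEquiv.toSpanNonzeroSingleton ℂ (Vec k) u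
      hu0).apply_symm_apply ⟨(2 : ℂ) • μ u y - y,
        Submodule.mem_span_singleton.2 ⟨c, hc.symm⟩⟩)).symm
  have hfu : f u = 1 := by
    have := hf u
    rw [hu] at this
    refine smul_left_injective ℂ hu0 ?_
    simp only [one_smul]
    rw [← this]
    module
  -- The Jordan identity at (n, u) yields f(n²) n = 0. If f(n²) = 0, then u n² = n² / 2, and the
  -- linearized identity at (n, u, u) forces n² = 0.
  have hsq (n : Vec k) (hn : f n = 0) : μ n n = 0 := by
    have hun : μ u n = (1 / 2 : ℂ) • n := by
      have := hf n
      rw [hn] at this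
      linear_combination (norm := module) (1 / 2 : ℂ) • this
    have hun2 : μ u (μ n n) = (1 / 2 : ℂ) • (μ n n + f (μ n n) • u) := by
      linear_combination (norm := module) (1 / 2 : ℂ) • hf (μ n n)
    have h1 := h.2 n u
    rw [h.1 (μ n n) u, hun2, hun] at h1
    simp only [map_add, LinearMap.map_smul, LinearMap.add_apply, LinearMap.smul_apply, hun] at h1
    have h2 : f (μ n n) • n = 0 := by linear_combination (norm := module) (4 : ℂ) • h1
    rcases smul_eq_zero.1 h2 with h3 | h3
    · have h4 := h.linearized n u u
      rw [h3] at hun2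
      rw [h.1 n u, hun, h.1 (μ n n) u, hun2, hu, h.1 (μ n n) u, hun2] at h4
      simp only [LinearMap.map_smul, LinearMap.smul_apply, zero_smul, add_zero, h.1 n u,
        h.1 (μ n n) u, hun, hun2] at h4
      linear_combination (norm := module) (-4 : ℂ) • h4
    · rw [h3, map_zero]
  have hmul (n m : Vec k) (hn : f n = 0) (hm : f m = 0) : μ n m = 0 := by
    have := hsq (n + m) (by simp [hn, hm])
    simp only [map_add, LinearMap.add_apply, hsq n hn, hsq m hm, h.1 m n] at this
    refine (smul_eq_zero.1 (?_ : (2 : ℂ) • μ n m = 0)).resolve_left two_ne_zero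
    rw [← this]
    module
  refine ⟨f, fun h0 => by simp [h0] at hfu, LinearMap.ext fun x => LinearMap.ext fun y => ?_⟩
  have hxy := hmul (x - f x • u) (y - f y • u) (by simp [hfu]) (by simp [hfu])
  simp only [map_sub, LinearMap.sub_apply, LinearMap.map_smul, LinearMap.smul_apply, hu,
    h.1 x u] at hxy
  rw [dualMul_apply]
  have h1 := hf x
  have h2 := hf y
  linear_combination (norm := module) hxy + (f y / 2) • h1 + (f x / 2) • h2

/-- The operator `L_{x²} - L_x² + φ ⊗ x`. -/
noncomputable def squareDefect (μ : AlgStr k) (x : Vec k) (φ : Vec k →ₗ[ℂ] ℂ) :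
    Vec k →ₗ[ℂ] Vec k :=
  μ (μ x x) - μ x ∘ₗ μ x + φ.smulRight x

theorem squareDefect_apply (μ : AlgStr k) (x : Vec k) (φ : Vec k →ₗ[ℂ] ℂ) (v : Vec k) :
    squareDefect μ x φ v = μ (μ x x) v - μ x (μ x v) + φ v • x := rfl

theorem mul_mem_polyFun {v w : AlgStr k → Vec k} (hv : ∀ i, (fun μ => v μ i) ∈ polyFun k)
    (hw : ∀ i, (fun μ => w μ i) ∈ polyFun k) (l : Fin k) :
    (fun μ => μ (v μ) (w μ) l) ∈ polyFun k := by
  have : (fun μ : AlgStr k => μ (v μ) (w μ) l) = ∑ i, ∑ j,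
      (fun μ => v μ i) * (fun μ => w μ j) * fun μ => structConst μ (i, j, l) := by
    funext μ
    simp [apply_eq_sum_structConst, Finset.sum_apply]
  rw [this]
  exact sum_mem fun i _ => sum_mem fun j _ =>
    mul_mem (mul_mem (hv i) (hw j)) (structConst_mem_polyFun _)

theorem const_mem_polyFun (c : ℂ) : (fun _ : AlgStr k => c) ∈ polyFun k :=
  (polyFun k).algebraMap_mem c

theorem det_squareDefect_mem_polyFun (x : Vec k) (φ : Vec k →ₗ[ℂ] ℂ) :
    (fun μ : AlgStr k => LinearMap.det (squareDefect μ x φ)) ∈ polyFun k := by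
  have : (fun μ : AlgStr k => LinearMap.det (squareDefect μ x φ)) =
      ∑ σ : Equiv.Perm (Fin k), ((Equiv.Perm.sign σ : ℤ) : ℂ) • ∏ i, fun μ : AlgStr k =>
        squareDefect μ x φ (Pi.single i 1) (σ i) := by
    funext μ
    rw [← LinearMap.det_toMatrix', Matrix.det_apply']
    simp [Finset.sum_apply, Finset.prod_apply, LinearMap.toMatrix'_apply]
  rw [this]
  refine sum_mem fun σ _ => Subalgebra.smul_mem _
    (Subalgebra.prod_mem (polyFun k) fun i _ => ?_) _
  exact add_mem (sub_mem
    (mul_mem_polyFun (v := fun μ => μ x x) (w := fun _ => Pi.single i 1)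
      (fun l => apply_mem_polyFun x x l) (fun l => const_mem_polyFun _) _)
    (mul_mem_polyFun (v := fun _ => x) (w := fun μ => μ x (Pi.single i 1))
      (fun l => const_mem_polyFun _) (fun l => apply_mem_polyFun _ _ l) _))
    (const_mem_polyFun _)

/-- Invertibility makes the kernel of L_{x²} - L_x² at most a line. It contains x and x², so x² is a
multiple of x, nonzero by `hφ`. -/
theorem eq_dualMul_of_det_squareDefect_ne_zero {μ : AlgStr k} (h : IsJordanMul μ) {x : Vec k}
    {φ : Vec k →ₗ[ℂ] ℂ} (hdet : LinearMap.det (squareDefect μ x φ) ≠ 0) (hφ : φ (μ x x) ≠ 0) :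
    ∃ f : Vec k →ₗ[ℂ] ℂ, f ≠ 0 ∧ μ = dualMul f := by
  have hinj : ∀ v, squareDefect μ x φ v = 0 → v = 0 := fun v hv => by
    by_contra hne
    refine hdet (LinearMap.det_eq_zero_iff_ker_ne_bot.2 fun hb => hne ?_)
    exact (LinearMap.ker_eq_bot'.1 hb) v hv
  have hx : μ (μ x x) x - μ x (μ x x) = 0 := sub_eq_zero.2 (h.1 _ _)
  have hxx : μ (μ x x) (μ x x) - μ x (μ x (μ x x)) = 0 := by
    rw [← h.2 x x, h.1 (μ x x) x, h.1 (μ x (μ x x)) x, sub_self]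
  -- The perturbed operator kills φ(x) v - φ(v) x.
  have hker (v : Vec k) (hv : μ (μ x x) v - μ x (μ x v) = 0) : φ x • v = φ v • x := by
    refine sub_eq_zero.1 (hinj _ ?_)
    rw [map_sub, map_smul, map_smul, squareDefect_apply, squareDefect_apply, hv, hx]
    module
  have hx0 : x ≠ 0 := fun h0 => hφ (by simp [h0])
  have hφx : φ x ≠ 0 := fun h0 => by
    have := hker _ hxx
    rw [h0, zero_smul] at this
    exact (smul_ne_zero hφ hx0) this.symm
  obtain ⟨c, hc0, hc⟩ : ∃ c : ℂ, c ≠ 0 ∧ μ x x = c • x := by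
    refine ⟨(φ x)⁻¹ * φ (μ x x), mul_ne_zero (inv_ne_zero hφx) hφ, ?_⟩
    rw [mul_smul, ← hker _ hxx, inv_smul_smul₀ hφx]
  refine eq_dualMul_of_idempotent h (u := c⁻¹ • x) (smul_ne_zero (inv_ne_zero hc0) hx0) ?_
    fun y hy => ?_
  · simp only [map_smul, LinearMap.smul_apply, hc, inv_smul_smul₀ hc0]
  · simp only [map_smul, LinearMap.smul_apply] at hy
    have hy' : μ x (μ x y) = c • μ x y := by
      have h1 : c⁻¹ • μ x (μ x y) = μ x y := smul_right_injective _ (inv_ne_zero hc0) hy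
      rw [← congrArg (c • ·) h1, smul_inv_smul₀ hc0]
    have := hker y (by rw [hc, hy', map_smul, LinearMap.smul_apply, sub_self])
    refine ⟨(φ x)⁻¹ * φ y * c, ?_⟩
    rw [mul_smul, smul_inv_smul₀ hc0, mul_smul, ← this, inv_smul_smul₀ hφx]

theorem isRigid_marginal (hk : 2 ≤ k) : IsRigid (marginal k hk) := by
  refine isOpen_iff_mem_nhds.2 fun ν hν => ?_
  obtain ⟨f, hf0, hf⟩ := (mem_orbit_marginal_iff hk).1 hν
  obtain ⟨x, hx⟩ : ∃ x, f x = 1 := by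
    obtain ⟨a, ha⟩ := DFunLike.ne_iff.1 hf0
    exact ⟨(f a)⁻¹ • a, by rw [map_smul, smul_eq_mul, inv_mul_cancel₀ ha]⟩
  have hxx : dualMul f x x = x := by
    rw [dualMul_apply, hx]
    module
  have hopen := (isOpen_ne_zero (det_squareDefect_mem_polyFun x f)).inter (isOpen_ne_zero
    (F := fun μ => ∑ i, f (Pi.single i 1) • μ x x i) (by
      have : (fun μ : AlgStr k => ∑ i, f (Pi.single i 1) • μ x x i) =
          ∑ i, f (Pi.single i 1) • fun μ : AlgStr k => μ x x i := by
        funext μ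
        simp [Finset.sum_apply]
      rw [this]
      exact sum_mem fun i _ => Subalgebra.smul_mem _ (apply_mem_polyFun x x i) _))
  have hsum (v : Vec k) : ∑ i, f (Pi.single i 1) • v i = f v := by
    conv_rhs => rw [pi_eq_sum_univ' v, map_sum]
    simp [mul_comm]
  simp only [hsum] at hopen
  refine Filter.mem_of_superset (hopen.mem_nhds ⟨?_, ?_⟩) fun ρ hρ => ?_
  · change LinearMap.det (squareDefect ν.1 x f) ≠ 0
    intro h0
    refine LinearMap.det_eq_zero_iff_ker_ne_bot.1 h0 (LinearMap.ker_eq_bot'.2 fun v hv => ?_)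
    rw [squareDefect_apply, hf, hxx] at hv
    simp only [dualMul_apply, hx, map_smul, map_add] at hv
    -- At ν the operator is v ↦ (v + 3 f(v) x) / 4; applying f gives f(v) = 0, then v = 0.
    have hv' : v + (3 * f v) • x = 0 := by linear_combination (norm := module) (4 : ℂ) • hv
    have hfv := congrArg f hv'
    rw [map_add, map_smul, hx, map_zero, smul_eq_mul] at hfv
    have h1 : f v = 0 := by linear_combination (1 / 4 : ℂ) * hfv
    simpa [h1] using hv'
  · change f (ν.1 x x) ≠ 0
    rw [hf, hxx, hx]
    exact one_ne_zero
  · exact (mem_orbit_marginal_iff hk).2 (eq_dualMul_of_det_squareDefect_ne_zero ρ.2 hρ.1 hρ.2)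

/-! ### A Jordan algebra outside the closure of the orbit of `𝔍_k` -/

/-- The multiplication with `e₀² = e₁` and all other products of basis vectors zero. -/
noncomputable def nilSquare (hk : 2 ≤ k) : Jord k :=
  ⟨LinearMap.mk₂ ℂ (fun x y => (x ⟨0, by omega⟩ * y ⟨0, by omega⟩) •
      (Pi.single ⟨1, by omega⟩ 1 : Vec k))
    (by intros; simp only [Pi.add_apply]; module)
    (by intros; simp only [Pi.smul_apply, smul_eq_mul]; module)
    (by intros; simp only [Pi.add_apply]; module)
    (by intros; simp only [Pi.smul_apply, smul_eq_mul]; module), by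
    refine ⟨fun x y => ?_, fun x y => ?_⟩
    · simp [mul_comm]
    · simp⟩

/-- In `dualMul f` every square x² is a multiple of x, unlike e₀² = e₁. -/
theorem nilSquare_notMem_closure (hk : 2 ≤ k) :
    nilSquare hk ∉ closure (orbit (marginal k hk)) := by
  intro h
  obtain ⟨f, hf⟩ := exists_dualMul_of_mem_closure
    (fun ρ hρ => ((mem_orbit_marginal_iff hk).1 hρ).imp fun f h => h.2) h
  have h1 : (nilSquare hk).1 (Pi.single ⟨0, by omega⟩ 1) (Pi.single ⟨0, by omega⟩ 1) =
      Pi.single ⟨1, by omega⟩ 1 := by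
    simp [nilSquare]
  rw [hf, dualMul_apply] at h1
  have := congrFun h1 ⟨1, by omega⟩
  simp at this

/-- A second component is essential: an empty intersection would be the whole variety. -/
theorem closure_orbit_marginal_inter (hk : 2 ≤ k) :
    closure (orbit (marginal k hk)) ∩ ⋂₀ (irreducibleComponents (Jord k) \
      {closure (orbit (marginal k hk))}) = {0} := by
  refine Set.Subset.antisymm ?_ (Set.singleton_subset_iff.2
    ⟨zero_mem_closure_orbit _, fun C hC => zero_mem_of_mem_irreducibleComponents hC.1⟩)
  rintro ν ⟨h1, h2⟩
  rw [closure_orbit_marginal] at h1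
  refine h1.resolve_left fun hν => ?_
  have hC := irreducibleComponent_mem_irreducibleComponents (nilSquare hk)
  have hne : irreducibleComponent (nilSquare hk) ≠ closure (orbit (marginal k hk)) := fun h =>
    nilSquare_notMem_closure hk (h ▸ mem_irreducibleComponent)
  exact hne (eq_closure_orbit_of_mem (isRigid_marginal hk) hν hC (h2 _ ⟨hC, hne⟩))

end JordVar

/-! ### The main theorem -/

theorem mainTheorem5 (k : ℕ) (hk : 2 ≤ k) :
    (∀ μ : JordVar.Jord k, JordVar.IsRigid μ → JordVar.level μ = 1 →
      closure (JordVar.orbit μ) ∈ irreducibleComponents (JordVar.Jord k) ∧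
      closure (JordVar.orbit μ) = JordVar.orbit μ ∪ {0} ∧
      {ν | ν ∈ closure (JordVar.orbit μ) ∧ ¬ JordVar.IsRigid ν} = {0}) ∧
    JordVar.IsRigid (JordVar.marginal k hk) ∧
    JordVar.level (JordVar.marginal k hk) = 1 ∧
    closure (JordVar.orbit (JordVar.marginal k hk)) ∩
      ⋂₀ (irreducibleComponents (JordVar.Jord k) \
        {closure (JordVar.orbit (JordVar.marginal k hk))}) = {0} ∧
    ¬ ∃ ν : JordVar.Jord k, ν ≠ 0 ∧ ∀ C ∈ irreducibleComponents (JordVar.Jord k), ν ∈ C := by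
  have hrigid := JordVar.isRigid_marginal hk
  have hzero := JordVar.not_isRigid_zero_of_ne (JordVar.marginal_ne_zero hk)
  refine ⟨fun μ hμ hl => ?_, hrigid, JordVar.level_eq_one_of_closure_orbit_eq
    (JordVar.marginal_ne_zero hk) (JordVar.closure_orbit_marginal hk),
    JordVar.closure_orbit_marginal_inter hk, ?_⟩
  · have hcl := JordVar.closure_orbit_eq_of_level_eq_one hl
    refine ⟨JordVar.closure_orbit_mem_irreducibleComponents hμ, hcl, ?_⟩
    refine Set.eq_singleton_iff_unique_mem.2 ⟨⟨JordVar.zero_mem_closure_orbit μ, hzero⟩, ?_⟩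
    rintro ν ⟨h1, h2⟩
    rw [hcl] at h1
    refine h1.resolve_left fun h => h2 ?_
    rw [JordVar.IsRigid, JordVar.orbit_eq h]
    exact hμ
  · rintro ⟨ν, hν, h⟩
    have : ν ∈ ({0} : Set (JordVar.Jord k)) := by
      rw [← JordVar.closure_orbit_marginal_inter hk]
      exact ⟨h _ (JordVar.closure_orbit_mem_irreducibleComponents hrigid), fun C hC => h C hC.1⟩
    exact hν this
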